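/- **Setting.** Let $f:\mathbb R^n\times\mathbb R^m\times\mathbb R^q\to\mathbb R^n$ and $\pi:\mathbb R^n\times\mathbb R^m\to\mathbb R^m$, and put $f_\pi(x,v,w)=f(x,\pi(x,v),w)$. Let $\mathbb Z\subseteq\mathbb R^n\times\mathbb R^m$ and $\mathbb W\subseteq\mathbb R^q$ be compact and convex with nonempty interior, $0\in\operatorname{int}\mathbb W$. Put $\mathbb Z_\pi=\{(x,v):(x,\pi(x,v))\in\mathbb Z\}$. Let $\Omega\subseteq\mathbb R^n$ be compact and robust control invariant, i.e. $f_\pi(x,v,w)-f_\pi(z,v,0)\in\Omega$ whenever $x-z\in\Omega$, $(x,v)\in\mathbb Z_\pi$, $w\in\mathbb W$. Put $\overline{\mathbb Z}=\{(z,v):(z+\epsilon,v)\in\mathbb Z_\pi\ \forall\epsilon\in\Omega\}$. Suppose $\Omega$ and $\overline{\mathbb Z}$ have nonempty interior. *Stage cost.* Let $L:\mathbb R^n\times\mathbb R^m\to\mathbb R$ be continuous, $L_\pi(x,v)=L(x,\pi(x,v))$, and let $\ell$ be one of $L_\pi(z,v)$, $\int_\Omega L_\pi(z+\epsilon,v)\,d\epsilon$,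 $\max_{\epsilon\in\Omega}L_\pi(z+\epsilon,v)$ (assumed well defined). Suppose $\ell$ is Lipschitz continuous on $\mathbb Z_\pi\cup\overline{\mathbb Z}$ (this set is $\mathbb Z_\pi$ if $0\in\Omega$). *Steady state.* Let $(z_s,v_s)\in\operatorname{int}\overline{\mathbb Z}$ minimize $\ell$ over $\{(z,v)\in\overline{\mathbb Z}:z=f_\pi(z,v,0)\}$. *Nominal problem.* For an input sequence $v$ let $\phi(t,z,v)$ be the solution of $z(t+1)=f_\pi(z(t),v(t),0)$, $z(0)=z$, and let $J_T(z,v)=\sum_{t=0}^{T-1}\ell(\phi(t,z,v),v(t))$. Given $X_f\subseteq\mathbb R^n$ and $V_f:\mathbb R^n\to\mathbb R$, let $V_N(z)$ be the minimum of $J_N(z,v)+V_f(\phi(N,z,v))$ over all $v$ with $(\phi(t,z,v),v(t))\in\overline{\mathbb Z}$ for $t<N$ and $\phi(N,z,v)\in X_f$. Let $\mathbb X_N$ be the set of all $z$ for which there are $(\tilde z,\tilde v):\mathbb N_0\to\overline{\mathbb Z}$ with $\tilde z(0)=z$, $\tilde z(t+1)=f_\pi(\tilde z(t),\tilde v(t),0)$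 for $t<N$, and $\tilde z(N)\in X_f$. Suppose that minimizers exist for all $N\ge1$ and fix one, $v_N^*(\cdot;z)$, for each $z\in\mathbb X_N$; suppose also that for every $x\in\mathbb X_N\oplus\Omega$ the minimum of $V_N(z)$ over $z\in\mathbb X_N$ with $x-z\in\Omega$ is attained, and fix a minimizer $z^*_{0}(x)$ (depending on $N$). *Closed loop.* Let $Z_N^{cl}(z)=\{z^*_{0}(x):x\in\{f_\pi(z,v_N^*(0;z),0)\}\oplus\Omega\}$. A closed-loop nominal sequence for horizon $N$ is a sequence $z_N(0|t)$, $t\ge0$, with $z_N(0|0)\in\mathbb X_N$ and $z_N(0|t+1)\in Z^{cl}_N(z_N(0|t))$. Its cost is $J_T^{cl}=\sum_{t=0}^{T-1}\ell\big(z_N(0|t),v_N^*(0;z_N(0|t))\big)$. *Comparison functions.* $\mathcal K$: continuous strictly increasing $\alpha:\mathbb R_{\ge0}\to\mathbb R_{\ge0}$ with $\alpha(0)=0$; $\mathcal K_\infty$: unbounded functions in $\mathcal K$; $\mathcal L$: continuous strictly decreasing $\delta:\mathbb R_{\ge0}\to\mathbb R_{\ge0}$ with $\delta(t)\to0$ as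 $t\to\infty$; $\mathcal{KL}$: functions $\beta:\mathbb R_{\ge0}^2\to\mathbb R_{\ge0}$ with $\beta(\cdot,t)\in\mathcal K$ for all $t\ge0$ and $\beta(r,\cdot)\in\mathcal L$ for all $r>0$. **Assumptions.** 1. *Terminal conditions.* $X_f$ is closed, $z_s\in\operatorname{int}X_f$, $V_f$ is continuous on $X_f$, and there is $\kappa_f:X_f\to\mathbb R^m$ such that for all $z\in X_f$: $(z,\kappa_f(z))\in\overline{\mathbb Z}$, $f_\pi(z,\kappa_f(z),0)\in X_f$, and $V_f(f_\pi(z,\kappa_f(z),0))-V_f(z)\le-\ell(z,\kappa_f(z))+\ell(z_s,v_s)$. 2. *Strict dissipativity.* There are a bounded $\lambda:\mathbb R^n\to\mathbb R$ and $\alpha_\ell\in\mathcal K_\infty$ such that $\lambda(f_\pi(z,v,0))-\lambda(z)\le\ell(z,v)-\ell(z_s,v_s)-\alpha_\ell(\|(z,v)-(z_s,v_s)\|)$ for all $(z,v)\in\overline{\mathbb Z}$; and, with the same $\lambda,\alpha_\ell$, for all $N\ge1$, $z\in\mathbb X_N$ and $y\in Z_N^{cl}(z)$, $\lambda(y)-\lambda(z)\le\ell(z,v)-\ell(z_s,v_s)-\alpha_\ell(\|(z,v)-(z_s,v_s)\|)$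 with $v=v_N^*(0;z)$. 3. *Exponential reachability.* For all $N\ge1$ and $z\in\mathbb X_N$ there are an input sequence $v$ with $(\phi(t,z,v),v(t))\in\overline{\mathbb Z}$ for all $t\geq 0$ and $c>0$, $\rho\in[0,1)$ with $\|(\phi(t,z,v),v(t))-(z_s,v_s)\|\le c\rho^t$ for all $t\ge0$. 4. *Local $M$-step controllability at $(z_s,v_s)$.* There is $M\in\mathbb N_0$ such that for every $\varepsilon>0$ there is $r>0$ such that for all $y,z\in\mathbb R^n$ with $\|y-z_s\|\le r$, $\|z-z_s\|\le r$ there is $v$ with $\phi(M,y,v)=z$ and $\|(\phi(t,y,v),v(t))-(z_s,v_s)\|\le\varepsilon$ for all $t<M$. 5. *Continuity of the value functions.* There is $\alpha_V\in\mathcal K_\infty$ with $|V_N(z)-V_N(z_s)|\le\alpha_V(\|z-z_s\|)$ for all $N\ge1$, $z\in\mathbb X_N$. **Theorem (transient performance with terminal conditions).** There exists $\beta\in\mathcal{KL}$ such that $$\|z_N(0|t)-z_s\|\le\beta(\|z_N(0|0)-z_s\|,t)\qquad(*)$$ for all $N\ge1$, all closed-loop nominal sequences for horizon $N$ and all $t\in\mathbb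 N_0$. Moreover, for every $\beta\in\mathcal{KL}$ with $(*)$ there are $\delta_1,\delta_2\in\mathcal L$ such that, for all $N\ge1$, all $T\in\mathbb N_0$ and all closed-loop nominal sequences for horizon $N$, $$J_T^{cl}\le\inf_{v}J_T(z_N(0|0),v)+\delta_1(N)+\delta_2(T),$$ where the infimum ($+\infty$ over the empty set) is over all $v$ with $(\phi(t,z_N(0|0),v),v(t))\in\overline{\mathbb Z}$ for $t<T$ and $\|\phi(T,z_N(0|0),v)-z_s\|\le\kappa$, with $\kappa=\beta(\|z_N(0|0)-z_s\|,T)$. -/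

import Mathlib

open Filter Topology
open scoped NNReal

noncomputable section

/-- Real coordinate space with the Euclidean norm. -/
abbrev EVec (d : ℕ) : Type := EuclideanSpace ℝ (Fin d)

/-! ### Comparison functions -/

/-- Class `K`. -/
def IsClassK (α : ℝ≥0 → ℝ≥0) : Prop :=
  Continuous α ∧ StrictMono α ∧ α 0 = 0

/-- Class `K∞`: the unbounded functions of class `K`. -/
def IsClassKInf (α : ℝ≥0 → ℝ≥0) : Prop :=
  IsClassK α ∧ ∀ b : ℝ≥0, ∃ r : ℝ≥0, b < α r

/-- Class `L`: continuous, strictly decreasing, with limit zero. -/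
def IsClassL (δ : ℝ≥0 → ℝ≥0) : Prop :=
  Continuous δ ∧ StrictAnti δ ∧ Tendsto δ atTop (𝓝 0)

/-- Class `KL`. The requirement on `β r ·` is made for `r > 0`, since `β 0 · = 0` by the
first requirement. -/
def IsClassKL (β : ℝ≥0 → ℝ≥0 → ℝ≥0) : Prop :=
  (∀ t, IsClassK fun r => β r t) ∧ ∀ r, 0 < r → IsClassL (β r)

/-! ### Data of the tube-based scheme -/

/-- The data of a tube-based economic MPC scheme with terminal conditions (no properties are
imposed here). -/
structure TubeMPC (n m q : ℕ) where
  /-- state transition map -/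
  f : EVec n → EVec m → EVec q → EVec n
  /-- parametrized feedback -/
  fb : EVec n → EVec m → EVec m
  /-- state and input constraint set -/
  con : Set (EVec n × EVec m)
  /-- disturbance set -/
  dist : Set (EVec q)
  /-- robust control invariant set -/
  Ω : Set (EVec n)
  /-- original stage cost -/
  L : EVec n × EVec m → ℝ
  /-- stage cost used by the controller -/
  ell : EVec n × EVec m → ℝ
  /-- terminal region -/
  Xf : Set (EVec n)
  /-- terminal cost -/
  Vf : EVec n → ℝ
  /-- state of the robust optimal steady state -/
  zs : EVec n
  /-- input of the robust optimal steady state -/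
  vs : EVec m
  /-- `vOpt N z` is the selected optimal input sequence for horizon `N` from `z` -/
  vOpt : ℕ → EVec n → ℕ → EVec m
  /-- `zOpt N x` is the selected optimal nominal initial state for the measured state `x` -/
  zOpt : ℕ → EVec n → EVec n

namespace TubeMPC

variable {n m q : ℕ} (S : TubeMPC n m q)

/-- Dynamics under the parametrized feedback. -/
def fPi (x : EVec n) (v : EVec m) (w : EVec q) : EVec n := S.f x (S.fb x v) w

/-- Constraint set in the variables `(x, v)`. -/
def conPi : Set (EVec n × EVec m) := {p | (p.1, S.fb p.1 p.2) ∈ S.con}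

/-- Tightened constraint set for the nominal state and the input. -/
def tight : Set (EVec n × EVec m) := {p | ∀ e ∈ S.Ω, (p.1 + e, p.2) ∈ S.conPi}

/-- Robust control invariance of `Ω` for the error system. -/
def IsRCI : Prop :=
  IsCompact S.Ω ∧ ∀ (x z : EVec n) (v : EVec m), x - z ∈ S.Ω → (x, v) ∈ S.conPi →
    ∀ w ∈ S.dist, S.fPi x v w - S.fPi z v 0 ∈ S.Ω

/-- The original stage cost under the parametrized feedback. -/
def LPi (p : EVec n × EVec m) : ℝ := S.L (p.1, S.fb p.1 p.2)

/-- Euclidean distance of `(z, v)` to the steady state `(zs, vs)`. -/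
def ssDist (z : EVec n) (v : EVec m) : ℝ≥0 := ‖WithLp.toLp 2 (z - S.zs, v - S.vs)‖₊

/-- The points at which the stage cost is evaluated (this is just `conPi` when `0 ∈ Ω`). -/
def costDomain : Set (EVec n × EVec m) := S.conPi ∪ S.tight

/-- `ell` is one of the three stage costs: nominal, averaged over `Ω`, worst case over `Ω`
(the integral and the maximum being well defined). -/
def IsStageCost : Prop :=
  (∀ p ∈ S.costDomain, S.ell p = S.LPi p) ∨
  (∀ p ∈ S.costDomain,
    MeasureTheory.IntegrableOn (fun e => S.LPi (p.1 + e, p.2)) S.Ω ∧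
      S.ell p = ∫ e in S.Ω, S.LPi (p.1 + e, p.2)) ∨
  (∀ p ∈ S.costDomain,
    IsGreatest ((fun e => S.LPi (p.1 + e, p.2)) '' S.Ω) (S.ell p))

/-! ### Nominal optimal control problem -/

/-- Solution of the nominal system from `z` under the input sequence `v`. -/
def traj (z : EVec n) (v : ℕ → EVec m) : ℕ → EVec n
  | 0 => z
  | t + 1 => S.fPi (traj z v t) (v t) 0

/-- Admissible input sequences over the horizon `T` (only `v 0, …, v (T - 1)` matter). -/
def admissible (T : ℕ) (z : EVec n) : Set (ℕ → EVec m) :=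
  {v | ∀ t < T, (S.traj z v t, v t) ∈ S.tight}

/-- Admissible input sequences that steer the nominal state into the closed ball of radius `κ`
around `zs` in time `T`. -/
def admissibleToBall (κ : ℝ) (T : ℕ) (z : EVec n) : Set (ℕ → EVec m) :=
  {v ∈ S.admissible T z | ‖S.traj z v T - S.zs‖ ≤ κ}

/-- Open-loop cost `J_T`. -/
def J (T : ℕ) (z : EVec n) (v : ℕ → EVec m) : ℝ :=
  ∑ t ∈ Finset.range T, S.ell (S.traj z v t, v t)

/-- Inputs satisfying all constraints of the problem with horizon `N`, including the terminal
one. -/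
def feasibleInputs (N : ℕ) (z : EVec n) : Set (ℕ → EVec m) :=
  {v ∈ S.admissible N z | S.traj z v N ∈ S.Xf}

/-- Objective of the problem with horizon `N`. -/
def objective (N : ℕ) (z : EVec n) (v : ℕ → EVec m) : ℝ :=
  S.J N z v + S.Vf (S.traj z v N)

/-- Optimal value function. -/
def V (N : ℕ) (z : EVec n) : ℝ := sInf (S.objective N z '' S.feasibleInputs N z)

/-- Set of nominal initial states that are feasible over the horizon `N`. -/
def XN (N : ℕ) : Set (EVec n) :=
  {z | ∃ (z' : ℕ → EVec n) (v' : ℕ → EVec m), (∀ t, (z' t, v' t) ∈ S.tight) ∧ z' 0 = z ∧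
    (∀ t < N, z' (t + 1) = S.fPi (z' t) (v' t) 0) ∧ z' N ∈ S.Xf}

/-- `vOpt` and `zOpt` are minimizers of the nominal problem and of the problem in which the
nominal initial state is optimized. -/
def HasMinimizers : Prop :=
  ∀ N : ℕ, 1 ≤ N →
    (∀ z ∈ S.XN N, S.vOpt N z ∈ S.feasibleInputs N z ∧
      ∀ v ∈ S.feasibleInputs N z, S.objective N z (S.vOpt N z) ≤ S.objective N z v) ∧
    (∀ x : EVec n, (∃ z ∈ S.XN N, x - z ∈ S.Ω) →
      S.zOpt N x ∈ S.XN N ∧ x - S.zOpt N x ∈ S.Ω ∧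
        ∀ z ∈ S.XN N, x - z ∈ S.Ω → S.V N (S.zOpt N x) ≤ S.V N z)

/-! ### Closed loop -/

/-- Set of all possible next nominal states. -/
def Zcl (N : ℕ) (z : EVec n) : Set (EVec n) :=
  {y | ∃ e ∈ S.Ω, y = S.zOpt N (S.fPi z (S.vOpt N z 0) 0 + e)}

/-- `z t` is the closed-loop nominal state `z_N(0|t)`. -/
def IsClosedLoop (N : ℕ) (z : ℕ → EVec n) : Prop :=
  z 0 ∈ S.XN N ∧ ∀ t, z (t + 1) ∈ S.Zcl N (z t)

/-- Closed-loop nominal cost over the horizon `T`. -/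
def Jcl (N T : ℕ) (z : ℕ → EVec n) : ℝ :=
  ∑ t ∈ Finset.range T, S.ell (z t, S.vOpt N (z t) 0)

/-- The closed-loop convergence bound, uniform over all prediction horizons. -/
def ConvergenceBound (β : ℝ≥0 → ℝ≥0 → ℝ≥0) : Prop :=
  ∀ N : ℕ, 1 ≤ N → ∀ z : ℕ → EVec n, S.IsClosedLoop N z →
    ∀ t : ℕ, ‖z t - S.zs‖₊ ≤ β ‖z 0 - S.zs‖₊ t

/-! ### Assumptions -/

/-- Constraint and disturbance sets. -/
def ConstraintSets : Prop :=
  IsCompact S.con ∧ Convex ℝ S.con ∧ (interior S.con).Nonempty ∧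
  IsCompact S.dist ∧ Convex ℝ S.dist ∧ (0 : EVec q) ∈ interior S.dist

/-- `Ω` is robust control invariant, and `Ω` and the tightened set have nonempty interior. -/
def RCISet : Prop :=
  S.IsRCI ∧ (interior S.Ω).Nonempty ∧ (interior S.tight).Nonempty

/-- The stage cost arises from a continuous cost `L` and is Lipschitz continuous. -/
def StageCost : Prop :=
  Continuous S.L ∧ S.IsStageCost ∧ ∃ K : ℝ≥0, 0 < K ∧ LipschitzOnWith K S.ell S.costDomain

/-- Terminal region, terminal cost and local auxiliary controller. -/
def Terminal : Prop :=
  IsClosed S.Xf ∧ S.zs ∈ interior S.Xf ∧ ContinuousOn S.Vf S.Xf ∧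
  ∃ κf : EVec n → EVec m, ∀ z ∈ S.Xf, (z, κf z) ∈ S.tight ∧ S.fPi z (κf z) 0 ∈ S.Xf ∧
    S.Vf (S.fPi z (κf z) 0) - S.Vf z ≤ -S.ell (z, κf z) + S.ell (S.zs, S.vs)

/-- `(zs, vs)` minimizes the stage cost over all steady states in the tightened set, and lies
in the interior of that set. -/
def ROSS : Prop :=
  S.zs = S.fPi S.zs S.vs 0 ∧
  (∀ z v, (z, v) ∈ S.tight → z = S.fPi z v 0 → S.ell (S.zs, S.vs) ≤ S.ell (z, v)) ∧
  (S.zs, S.vs) ∈ interior S.tight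

/-- Strict dissipativity of the nominal system with bounded storage function `lam`. -/
def StrictDissipativity (lam : EVec n → ℝ) (αℓ : ℝ≥0 → ℝ≥0) : Prop :=
  IsClassKInf αℓ ∧ (∃ C, ∀ z, |lam z| ≤ C) ∧
  ∀ z v, (z, v) ∈ S.tight →
    lam (S.fPi z v 0) - lam z ≤ S.ell (z, v) - S.ell (S.zs, S.vs) - αℓ (S.ssDist z v)

/-- The dissipation inequality along the closed loop. -/
def ClosedLoopDissipativity (lam : EVec n → ℝ) (αℓ : ℝ≥0 → ℝ≥0) : Prop :=
  ∀ N : ℕ, 1 ≤ N → ∀ z ∈ S.XN N, ∀ y ∈ S.Zcl N z,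
    lam y - lam z ≤ S.ell (z, S.vOpt N z 0) - S.ell (S.zs, S.vs)
      - αℓ (S.ssDist z (S.vOpt N z 0))

/-- Exponential reachability of the steady state from every feasible initial state. -/
def ExponentiallyReachable : Prop :=
  ∀ N : ℕ, 1 ≤ N → ∀ z ∈ S.XN N, ∃ v : ℕ → EVec m, (∀ t, (S.traj z v t, v t) ∈ S.tight) ∧
    ∃ c ρ : ℝ, 0 < c ∧ 0 ≤ ρ ∧ ρ < 1 ∧ ∀ t, (S.ssDist (S.traj z v t) (v t) : ℝ) ≤ c * ρ ^ t

/-- Local `M`-step controllability of the nominal system at `(zs, vs)` for some `M`: points near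
`zs` can be steered to each other in `M` steps along a path that stays near `(zs, vs)`. -/
def LocallyControllable : Prop :=
  ∃ M : ℕ, ∀ ε : ℝ, 0 < ε → ∃ r : ℝ, 0 < r ∧ ∀ y z : EVec n, ‖y - S.zs‖ ≤ r → ‖z - S.zs‖ ≤ r →
    ∃ v : ℕ → EVec m, S.traj y v M = z ∧ ∀ t < M, (S.ssDist (S.traj y v t) (v t) : ℝ) ≤ ε

/-- Continuity of the optimal value functions at the steady state, uniformly in the horizon. -/
def ValueContinuity : Prop :=
  ∃ αV : ℝ≥0 → ℝ≥0, IsClassKInf αV ∧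
    ∀ N : ℕ, 1 ≤ N → ∀ z ∈ S.XN N, |S.V N z - S.V N S.zs| ≤ αV ‖z - S.zs‖₊

end TubeMPC

end

/-! Write `ℓₛ` for the steady-state cost. Shifting the optimal input and appending the terminal
controller shows that `V_N` drops by at least `ℓ - ℓₛ` in each closed-loop step (`closedLoop_step`).
Adding the storage function rotates this into a strict decrease. The rotated value is dominated by a
`K∞` function of the distance to `zs`, thanks to value continuity and to continuity of the storage
at `zs`, which local controllability supplies (`lam_continuousAt`). A Lyapunov argument
(`exists_isClassKL_of_decrease`) then yields a `KL` bound that does not depend on `N`.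

For performance, telescoping gives `Jcl ≤ V_N(z 0) - V_N(z T) + T ℓₛ`. A competitor with large
excess over `T ℓₛ` loses outright. Any other one is forced by dissipativity to be near `zs` at some
time `P` bounded independently of `N` and `T` (`exists_close_time`). Up to `P`, dynamic programming
compares `V_N(z 0)` with its cost plus `V_(N-P)` near `zs`, and `V_(N-P)(zs)` exceeds `V_N(zs) - P
ℓₛ` by at most a small error (`V_zs_le`). After `P` the competitor runs from near `zs` to near `zs`,
so it pays at least about `(T-P) ℓₛ`. Hence the performance gap is uniformly bounded
(`Jcl_sub_J_le`) and has arbitrarily small upper bounds for large `min N T` (`Jcl_sub_J_small`);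
`exists_isClassKInf_majorant` turns this into a class `L` error. -/

/-! ### Comparison functions. -/

/-- A bounded quantity that vanishes as the size tends to zero is dominated by a `K∞` function
of the size. -/
theorem exists_isClassKInf_majorant {X : Type*} (s : X → ℝ≥0) (a : X → ℝ) (B : ℝ)
    (hB : ∀ x, a x ≤ B) (h : ∀ ε : ℝ, 0 < ε → ∃ r : ℝ, 0 < r ∧ ∀ x, (s x : ℝ) ≤ r → a x ≤ ε) :
    ∃ σ : ℝ≥0 → ℝ≥0, IsClassKInf σ ∧ ∀ x, a x ≤ σ (s x) := by
  obtain ⟨b, hb, hBb⟩ : ∃ b : ℝ, 0 < b ∧ B ≤ b :=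
    ⟨max B 1, lt_max_of_lt_right one_pos, le_max_left _ _⟩
  choose ρ hρ0 hρ using fun j : ℕ => h (b * (1 / 2) ^ j) (by positivity)
  have hsum : Summable fun j : ℕ => b * (1 / 2 : ℝ) ^ j := summable_geometric_two.mul_left b
  -- A ramp of height `b / 2 ^ j` that saturates at `ρ j`; the majorant is the sum of all ramps,
  -- plus `r` to make it strictly increasing and unbounded.
  let u : ℕ → ℝ≥0 → ℝ := fun j r => b * (1 / 2) ^ j * min 1 ((r : ℝ) / ρ j)
  have hu0 : ∀ j r, 0 ≤ u j r := fun j r => by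
    have := (hρ0 j).le
    positivity
  have hu1 : ∀ j r, u j r ≤ b * (1 / 2) ^ j := fun j r =>
    mul_le_of_le_one_right (by positivity) (min_le_left _ _)
  have hus : ∀ r, Summable fun j => u j r := fun r =>
    Summable.of_nonneg_of_le (fun j => hu0 j r) (fun j => hu1 j r) hsum
  have hum : ∀ j, Monotone (u j) := fun j r r' hr => by
    have := hρ0 j
    have : (r : ℝ) ≤ r' := hr
    dsimp only [u]
    gcongr
  have hcont : Continuous fun r => ∑' j, u j r := by
    refine continuous_tsum (fun j => by dsimp only [u]; fun_prop) hsum fun j r => ?_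
    rw [Real.norm_of_nonneg (hu0 j r)]
    exact hu1 j r
  refine ⟨fun r => r + (∑' j, u j r).toNNReal, ⟨⟨?_, ?_, ?_⟩, fun c => ⟨c + 1, ?_⟩⟩, fun x => ?_⟩
  · fun_prop
  · exact strictMono_id.add_monotone fun r r' hr =>
      Real.toNNReal_le_toNNReal ((hus r).tsum_le_tsum (fun j => hum j hr) (hus r'))
  · simp [u]
  · exact lt_of_lt_of_le (lt_add_one c) le_self_add
  · rw [NNReal.coe_add, Real.coe_toNNReal _ (tsum_nonneg fun j => hu0 j _)]
    rcases le_or_gt (a x) 0 with hx | hx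
    · exact hx.trans (add_nonneg (s x).2 (tsum_nonneg fun j => hu0 j _))
    have hex : ∃ k : ℕ, b * (1 / 2 : ℝ) ^ k < a x := by
      obtain ⟨k, hk⟩ := exists_pow_lt_of_lt_one (div_pos hx hb) (by norm_num : (1 / 2 : ℝ) < 1)
      exact ⟨k, by rwa [lt_div_iff₀' hb] at hk⟩
    classical
    -- At the first dyadic level below `a x`, and at all later ones, `s x` exceeds `ρ j`, so those
    -- ramps are saturated; together they sum to the previous level, which is at least `a x`.
    obtain ⟨k, hk⟩ : ∃ k, Nat.find hex = k + 1 := Nat.exists_eq_succ_of_ne_zero fun h0 => by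
      have h1 := Nat.find_spec hex
      rw [h0] at h1
      linarith [hB x]
    have hak : a x ≤ b * (1 / 2) ^ k := not_lt.1 (Nat.find_min hex (by omega))
    have hbig : ∀ j, u (j + (k + 1)) (s x) = b * (1 / 2) ^ k * ((1 / 2) * (1 / 2) ^ j) := fun j => by
      have hlt : b * (1 / 2 : ℝ) ^ (j + (k + 1)) < a x := by
        refine lt_of_le_of_lt ?_ (Nat.find_spec hex)
        rw [hk]
        exact mul_le_mul_of_nonneg_left
          (pow_le_pow_of_le_one (by norm_num) (by norm_num) (by omega)) hb.le
      have hs : ρ (j + (k + 1)) < s x :=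
        not_le.1 fun hle => absurd (hρ _ x hle) (not_le.2 hlt)
      have : 1 ≤ (s x : ℝ) / ρ (j + (k + 1)) := (one_le_div (hρ0 _)).2 hs.le
      dsimp only [u]
      rw [min_eq_left this]
      ring
    have htail : ∑' j, u (j + (k + 1)) (s x) = b * (1 / 2) ^ k := by
      simp_rw [hbig]
      rw [tsum_mul_left, tsum_mul_left, tsum_geometric_two]
      ring
    have := (hus (s x)).sum_add_tsum_nat_add (k + 1)
    have h0 : 0 ≤ ∑ j ∈ Finset.range (k + 1), u j (s x) := Finset.sum_nonneg fun j _ => hu0 j _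
    have := (s x).2
    linarith

/-- A `K∞` function is an order automorphism of the half line. -/
theorem IsClassKInf.exists_orderIso {α : ℝ≥0 → ℝ≥0} (h : IsClassKInf α) :
    ∃ e : ℝ≥0 ≃o ℝ≥0, ∀ r, e r = α r := by
  have hsurj : Function.Surjective α := fun c =>
    mem_range_of_exists_le_of_exists_ge h.1.1 ⟨0, by simp [h.1.2.2]⟩
      ((h.2 c).imp fun _ hr => hr.le)
  exact ⟨h.1.2.1.orderIsoOfSurjective α hsurj, fun _ => rfl⟩

theorem IsClassKInf.add {α γ : ℝ≥0 → ℝ≥0} (hα : IsClassKInf α) (hγ : IsClassKInf γ) :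
    IsClassKInf fun r => α r + γ r :=
  ⟨⟨hα.1.1.add hγ.1.1, hα.1.2.1.add hγ.1.2.1, by simp [hα.1.2.2, hγ.1.2.2]⟩,
    fun b => (hα.2 b).imp fun _ hr => hr.trans_le le_self_add⟩

/-- Composing a class `K` function with `t ↦ c / (t + 1)` gives a class `L` function. -/
theorem IsClassK.isClassL_div {α : ℝ≥0 → ℝ≥0} (h : IsClassK α) {c : ℝ≥0} (hc : 0 < c) :
    IsClassL fun t => α (c / (t + 1)) := by
  have hcont : Continuous fun t : ℝ≥0 => c / (t + 1) :=
    continuous_const.div₀ (by fun_prop) fun t => by positivity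
  refine ⟨h.1.comp hcont, fun t t' ht => h.2.1 ?_, ?_⟩
  · gcongr
  · rw [← h.2.2]
    refine (h.1.tendsto 0).comp ?_
    rw [← NNReal.tendsto_coe]
    push_cast
    exact (tendsto_atTop_add_const_right _ _
      (NNReal.tendsto_coe_atTop.2 tendsto_id)).const_div_atTop (c : ℝ)

theorem OrderIso.isClassK (e : ℝ≥0 ≃o ℝ≥0) : IsClassK e :=
  ⟨e.continuous, e.strictMono, e.map_bot⟩

/-- Small values of a `K∞` function come from small arguments. -/
theorem IsClassKInf.exists_pos_of_lt {α : ℝ≥0 → ℝ≥0} (h : IsClassKInf α) {ε : ℝ} (hε : 0 < ε) :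
    ∃ η : ℝ, 0 < η ∧ ∀ r : ℝ≥0, (α r : ℝ) < η → (r : ℝ) < ε := by
  lift ε to ℝ≥0 using hε.le
  refine ⟨α ε, ?_, fun r hr => ?_⟩
  · have := h.1.2.1 (NNReal.coe_pos.1 hε)
    rw [h.1.2.2] at this
    exact_mod_cast this
  · exact_mod_cast h.1.2.1.lt_iff_lt.1 (NNReal.coe_lt_coe.1 hr)

/-- A class `K` function is small at small arguments. -/
theorem IsClassK.exists_pos_of_le {α : ℝ≥0 → ℝ≥0} (h : IsClassK α) {ε : ℝ} (hε : 0 < ε) :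
    ∃ r : ℝ, 0 < r ∧ ∀ x : ℝ≥0, (x : ℝ) ≤ r → (α x : ℝ) ≤ ε := by
  have h0 : Tendsto (fun x => (α x : ℝ)) (𝓝 0) (𝓝 0) := by
    simpa [h.2.2, Function.comp_def] using (NNReal.continuous_coe.comp h.1).tendsto 0
  obtain ⟨r, hr, hball⟩ := Metric.eventually_nhds_iff.1 (h0.eventually (ge_mem_nhds hε))
  refine ⟨r / 2, by positivity, fun x hx => hball ?_⟩
  rw [NNReal.dist_eq]
  simp only [NNReal.coe_zero, sub_zero, NNReal.abs_eq]
  linarith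

/-- The sequence that follows `v` for `P` steps and `w` afterwards. -/
def concatSeq {α : Type*} (P : ℕ) (v w : ℕ → α) : ℕ → α :=
  fun t => if t < P then v t else w (t - P)

theorem concatSeq_of_lt {α : Type*} {P t : ℕ} (v w : ℕ → α) (h : t < P) :
    concatSeq P v w t = v t := if_pos h

theorem concatSeq_add {α : Type*} (P t : ℕ) (v w : ℕ → α) :
    concatSeq P v w (P + t) = w t := by simp [concatSeq]

namespace TubeMPC

variable {n m q : ℕ} (S : TubeMPC n m q)

/-! ### Trajectories and concatenation of inputs -/

theorem traj_congr {z : EVec n} {v w : ℕ → EVec m} {t : ℕ} (h : ∀ s < t, v s = w s) :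
    S.traj z v t = S.traj z w t := by
  induction t with
  | zero => rfl
  | succ t ih => simp only [traj, ih fun s hs => h s (by omega), h t (by omega)]

theorem traj_add (z : EVec n) (v : ℕ → EVec m) (P t : ℕ) :
    S.traj z v (P + t) = S.traj (S.traj z v P) (fun s => v (P + s)) t := by
  induction t with
  | zero => rfl
  | succ t ih => rw [← add_assoc]; simp only [traj, ih]

theorem traj_concatSeq (z : EVec n) (v w : ℕ → EVec m) {P t : ℕ} (h : t ≤ P) :
    S.traj z (concatSeq P v w) t = S.traj z v t :=
  S.traj_congr fun _ hs => concatSeq_of_lt v w (by omega)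

theorem traj_concatSeq_add (z : EVec n) (v w : ℕ → EVec m) (P t : ℕ) :
    S.traj z (concatSeq P v w) (P + t) = S.traj (S.traj z v P) w t := by
  rw [traj_add, traj_concatSeq _ _ _ _ le_rfl]
  simp only [concatSeq_add]

theorem J_add (P K : ℕ) (z : EVec n) (v : ℕ → EVec m) :
    S.J (P + K) z v = S.J P z v + S.J K (S.traj z v P) (fun s => v (P + s)) := by
  simp only [J, Finset.sum_range_add, traj_add]

theorem J_concatSeq (P : ℕ) (z : EVec n) (v w : ℕ → EVec m) :
    S.J P z (concatSeq P v w) = S.J P z v :=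
  Finset.sum_congr rfl fun t ht => by
    have ht := Finset.mem_range.1 ht
    rw [S.traj_concatSeq _ _ _ ht.le, concatSeq_of_lt _ _ ht]

variable {S}

theorem admissible_mono {P T : ℕ} (h : P ≤ T) {z : EVec n} {v : ℕ → EVec m}
    (hv : v ∈ S.admissible T z) : v ∈ S.admissible P z :=
  fun t ht => hv t (ht.trans_le h)

theorem admissible_shift {P K : ℕ} {z : EVec n} {v : ℕ → EVec m}
    (hv : v ∈ S.admissible (P + K) z) :
    (fun s => v (P + s)) ∈ S.admissible K (S.traj z v P) := fun t ht => by
  rw [← traj_add]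
  exact hv (P + t) (by omega)

theorem feasibleInputs_shift {P K : ℕ} {z : EVec n} {v : ℕ → EVec m}
    (hv : v ∈ S.feasibleInputs (P + K) z) :
    (fun s => v (P + s)) ∈ S.feasibleInputs K (S.traj z v P) :=
  ⟨admissible_shift hv.1, by rw [← traj_add]; exact hv.2⟩

theorem concatSeq_mem_feasibleInputs {P K : ℕ} {z : EVec n} {v w : ℕ → EVec m}
    (hv : v ∈ S.admissible P z) (hw : w ∈ S.feasibleInputs K (S.traj z v P)) :
    concatSeq P v w ∈ S.feasibleInputs (P + K) z := by
  refine ⟨fun t ht => ?_, by rw [traj_concatSeq_add]; exact hw.2⟩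
  rcases lt_or_ge t P with h | h
  · rw [S.traj_concatSeq _ _ _ h.le, concatSeq_of_lt _ _ h]
    exact hv t h
  · obtain ⟨s, rfl⟩ := Nat.exists_eq_add_of_le h
    rw [traj_concatSeq_add, concatSeq_add]
    exact hw.1 s (by omega)

theorem objective_concatSeq (P K : ℕ) (z : EVec n) (v w : ℕ → EVec m) :
    S.objective (P + K) z (concatSeq P v w) =
      S.J P z v + S.objective K (S.traj z v P) w := by
  simp only [objective, J_add, J_concatSeq, traj_concatSeq _ _ _ _ le_rfl, concatSeq_add,
    traj_concatSeq_add, add_assoc]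

theorem objective_add (P K : ℕ) (z : EVec n) (v : ℕ → EVec m) :
    S.objective (P + K) z v =
      S.J P z v + S.objective K (S.traj z v P) (fun s => v (P + s)) := by
  simp only [objective, J_add, ← traj_add, add_assoc]

/-! ### Feasibility and the value function -/

/-- `XN` asks for membership in `tight` at all times but for the dynamics only before `N`, so a
feasible path can be frozen at its endpoint, with the terminal controller's input there. -/
theorem mem_XN_iff (hterm : S.Terminal) {N : ℕ} {z : EVec n} :
    z ∈ S.XN N ↔ (S.feasibleInputs N z).Nonempty := by
  obtain ⟨-, -, -, κf, hκ⟩ := hterm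
  constructor
  · rintro ⟨z', v', ht, h0, hstep, hN⟩
    have htraj : ∀ t ≤ N, S.traj z v' t = z' t := fun t => by
      induction t with
      | zero => exact fun _ => h0.symm
      | succ t ih => intro h; rw [hstep t (by omega), traj, ih (by omega)]
    refine ⟨v', fun t h => ?_, ?_⟩
    · rw [htraj t h.le]
      exact ht t
    · rwa [htraj N le_rfl]
  · rintro ⟨v, hv, hN⟩
    refine ⟨fun t => S.traj z v (min t N),
      fun t => if t < N then v t else κf (S.traj z v N), fun t => ?_, by simp [traj],
      fun t ht => ?_, by simpa using hN⟩
    · rcases lt_or_ge t N with h | h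
      · simpa [h, h.le] using hv t h
      · simpa [h, not_lt.2 h] using (hκ _ hN).1
    · simp [ht, ht.le, traj]

/-- Appending one step of the terminal controller. -/
theorem exists_feasibleInputs_succ (hterm : S.Terminal) {K : ℕ} {z : EVec n} {v : ℕ → EVec m}
    (hv : v ∈ S.feasibleInputs K z) : ∃ w ∈ S.feasibleInputs (K + 1) z,
      S.objective (K + 1) z w ≤ S.objective K z v + S.ell (S.zs, S.vs) := by
  obtain ⟨-, -, -, κf, hκ⟩ := hterm
  obtain ⟨h1, h2, h3⟩ := hκ _ hv.2
  refine ⟨concatSeq K v fun _ => κf (S.traj z v K), concatSeq_mem_feasibleInputs hv.1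
    ⟨fun t ht => ?_, h2⟩, ?_⟩
  · obtain rfl : t = 0 := by omega
    exact h1
  · rw [objective_concatSeq]
    simp only [objective, J, Finset.sum_range_one, traj]
    linarith

theorem Xf_subset_XN (hterm : S.Terminal) (N : ℕ) : S.Xf ⊆ S.XN N := fun z hz => by
  rw [mem_XN_iff hterm]
  induction N with
  | zero => exact ⟨fun _ => 0, fun t ht => absurd ht (Nat.not_lt_zero t), hz⟩
  | succ N ih =>
    obtain ⟨v, hv⟩ := ih
    obtain ⟨w, hw, -⟩ := exists_feasibleInputs_succ hterm hv
    exact ⟨w, hw⟩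

theorem isLeast_V (hmin : S.HasMinimizers) {N : ℕ} (hN : 1 ≤ N) {z : EVec n}
    (hz : z ∈ S.XN N) :
    IsLeast (S.objective N z '' S.feasibleInputs N z) (S.objective N z (S.vOpt N z)) := by
  obtain ⟨h1, h2⟩ := (hmin N hN).1 z hz
  exact ⟨⟨_, h1, rfl⟩, by rintro _ ⟨v, hv, rfl⟩; exact h2 v hv⟩

theorem V_eq (hmin : S.HasMinimizers) {N : ℕ} (hN : 1 ≤ N) {z : EVec n} (hz : z ∈ S.XN N) :
    S.V N z = S.objective N z (S.vOpt N z) :=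
  (isLeast_V hmin hN hz).csInf_eq

theorem V_le (hmin : S.HasMinimizers) (hterm : S.Terminal) {N : ℕ} (hN : 1 ≤ N) {z : EVec n}
    {v : ℕ → EVec m} (hv : v ∈ S.feasibleInputs N z) : S.V N z ≤ S.objective N z v := by
  have hz := (mem_XN_iff hterm).2 ⟨v, hv⟩
  rw [V_eq hmin hN hz]
  exact ((hmin N hN).1 z hz).2 v hv

/-- Dynamic programming inequality. -/
theorem V_add_le (hmin : S.HasMinimizers) (hterm : S.Terminal) {P K : ℕ} (hK : 1 ≤ K)
    {z : EVec n} {v : ℕ → EVec m} (hv : v ∈ S.admissible P z)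
    (hz : S.traj z v P ∈ S.XN K) :
    S.V (P + K) z ≤ S.J P z v + S.V K (S.traj z v P) := by
  rw [V_eq hmin hK hz, ← objective_concatSeq]
  exact V_le hmin hterm (by omega)
    (concatSeq_mem_feasibleInputs hv ((hmin K hK).1 _ hz).1)

theorem V_succ_le (hmin : S.HasMinimizers) (hterm : S.Terminal) {K : ℕ} (hK : 1 ≤ K)
    {z : EVec n} (hz : z ∈ S.XN K) : S.V (K + 1) z ≤ S.V K z + S.ell (S.zs, S.vs) := by
  obtain ⟨w, hw, hle⟩ := exists_feasibleInputs_succ hterm ((hmin K hK).1 z hz).1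
  rw [V_eq hmin hK hz]
  exact (V_le hmin hterm (by omega) hw).trans hle

theorem vOpt_mem_tight (hmin : S.HasMinimizers) {N : ℕ} (hN : 1 ≤ N) {z : EVec n}
    (hz : z ∈ S.XN N) : (z, S.vOpt N z 0) ∈ S.tight :=
  ((hmin N hN).1 z hz).1.1 0 hN

/-! ### The closed loop -/

/-- The candidate is the nominal successor of `z`: the measured state differs from it by an element
of `Ω`, and the shifted optimal input extended by one terminal step is feasible from it. Optimizing
the nominal initial state can only lower the value. -/
theorem closedLoop_step (hmin : S.HasMinimizers) (hterm : S.Terminal) {N : ℕ} (hN : 1 ≤ N)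
    {z y : EVec n} (hz : z ∈ S.XN N) (hy : y ∈ S.Zcl N z) :
    y ∈ S.XN N ∧ S.V N y ≤ S.V N z - S.ell (z, S.vOpt N z 0) + S.ell (S.zs, S.vs) := by
  obtain ⟨K, rfl⟩ := Nat.exists_eq_add_of_le hN
  have hopt := ((hmin _ hN).1 z hz).1
  obtain ⟨w, hw, hle⟩ := exists_feasibleInputs_succ hterm (feasibleInputs_shift hopt)
  rw [add_comm K 1] at hw hle
  have hz1 := (mem_XN_iff hterm).2 ⟨w, hw⟩
  obtain ⟨e, he, rfl⟩ := hy
  have hx : S.fPi z (S.vOpt (1 + K) z 0) 0 + e - S.traj z (S.vOpt (1 + K) z) 1 ∈ S.Ω := by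
    simpa [traj] using he
  obtain ⟨h1, -, h3⟩ := (hmin _ hN).2 _ ⟨_, hz1, hx⟩
  refine ⟨h1, (h3 _ hz1 hx).trans ((V_le hmin hterm hN hw).trans (hle.trans ?_))⟩
  rw [V_eq hmin hN hz, objective_add]
  simp [J, traj]

theorem IsClosedLoop.mem_XN (hmin : S.HasMinimizers) (hterm : S.Terminal) {N : ℕ} (hN : 1 ≤ N)
    {z : ℕ → EVec n} (h : S.IsClosedLoop N z) (t : ℕ) : z t ∈ S.XN N := by
  induction t with
  | zero => exact h.1
  | succ t ih => exact (closedLoop_step hmin hterm hN ih (h.2 t)).1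

theorem IsClosedLoop.Jcl_le (hmin : S.HasMinimizers) (hterm : S.Terminal) {N : ℕ} (hN : 1 ≤ N)
    {z : ℕ → EVec n} (h : S.IsClosedLoop N z) (T : ℕ) :
    S.Jcl N T z ≤ S.V N (z 0) - S.V N (z T) + T * S.ell (S.zs, S.vs) := by
  induction T with
  | zero => simp [Jcl]
  | succ T ih =>
    have := (closedLoop_step hmin hterm hN (h.mem_XN hmin hterm hN T) (h.2 T)).2
    rw [Jcl, Finset.sum_range_succ, ← Jcl]
    push_cast
    linarith

/-! ### Distances and boundedness -/

theorem nnnorm_sub_le_ssDist (z : EVec n) (v : EVec m) : ‖z - S.zs‖₊ ≤ S.ssDist z v := by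
  have := WithLp.prod_nnnorm_eq_of_L2 (WithLp.toLp 2 (z - S.zs, v - S.vs))
  rw [ssDist, this]
  exact NNReal.le_sqrt_iff_sq_le.2 le_self_add

theorem dist_le_ssDist (z : EVec n) (v : EVec m) :
    Dist.dist (z, v) (S.zs, S.vs) ≤ S.ssDist z v := by
  have := WithLp.prod_nnnorm_eq_of_L2 (WithLp.toLp 2 (z - S.zs, v - S.vs))
  rw [Prod.dist_eq, dist_eq_norm, dist_eq_norm]
  refine max_le (NNReal.coe_le_coe.2 (nnnorm_sub_le_ssDist z v)) ?_
  rw [ssDist, this]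
  have h : ‖v - S.vs‖₊ ≤ NNReal.sqrt (‖z - S.zs‖₊ ^ 2 + ‖v - S.vs‖₊ ^ 2) :=
    NNReal.le_sqrt_iff_sq_le.2 le_add_self
  exact NNReal.coe_le_coe.2 h

/-- Shifting by one fixed element of `Ω` lands in the compact set `con`. Only the state is bounded,
since `fb` may be arbitrary in `v`. -/
theorem exists_norm_bound (hsets : S.ConstraintSets) (hrci : S.RCISet) :
    ∃ R : ℝ≥0, 0 < R ∧ ∀ z v, (z, v) ∈ S.tight → ‖z - S.zs‖₊ ≤ R := by
  obtain ⟨e, he⟩ := hrci.2.1.mono interior_subset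
  obtain ⟨C, hC⟩ := hsets.1.isBounded.exists_norm_le
  refine ⟨(C + ‖e‖ + ‖S.zs‖).toNNReal + 1, by positivity, fun z v h => ?_⟩
  have h1 : ‖z + e‖ ≤ C := (norm_fst_le _).trans (hC _ (h e he))
  have h2 : ‖z - S.zs‖ ≤ ‖z + e‖ + ‖e‖ + ‖S.zs‖ := by
    have := norm_sub_le (z + e - e) S.zs
    rw [add_sub_cancel_right] at this
    have := norm_sub_le (z + e) e
    rw [add_sub_cancel_right] at this
    linarith
  rw [← NNReal.coe_le_coe, coe_nnnorm, NNReal.coe_add, NNReal.coe_one]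
  linarith [Real.le_coe_toNNReal (C + ‖e‖ + ‖S.zs‖)]

theorem exists_norm_bound_XN (hmin : S.HasMinimizers) (hsets : S.ConstraintSets)
    (hrci : S.RCISet) :
    ∃ R : ℝ≥0, 0 < R ∧ ∀ N, 1 ≤ N → ∀ z ∈ S.XN N, ‖z - S.zs‖₊ ≤ R := by
  obtain ⟨R, hR0, hR⟩ := exists_norm_bound hsets hrci
  exact ⟨R, hR0, fun N hN z hz => hR _ _ (vOpt_mem_tight hmin hN hz)⟩

/-! ### Consequences of strict dissipativity -/

section Dissipativity

variable {lam : EVec n → ℝ} {αℓ : ℝ≥0 → ℝ≥0}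

theorem sum_le_of_dissipativity (hdiss : S.StrictDissipativity lam αℓ) {P : ℕ} {z : EVec n}
    {v : ℕ → EVec m} (hv : v ∈ S.admissible P z) :
    ∑ t ∈ Finset.range P, (αℓ (S.ssDist (S.traj z v t) (v t)) : ℝ) ≤
      S.J P z v - P * S.ell (S.zs, S.vs) + lam z - lam (S.traj z v P) := by
  induction P with
  | zero => simp [J, traj]
  | succ P ih =>
    have h1 := ih (admissible_mono P.le_succ hv)
    have h2 := hdiss.2.2 _ _ (hv P P.lt_succ_self)
    rw [Finset.sum_range_succ, J, Finset.sum_range_succ, ← J, traj]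
    push_cast
    linarith

theorem lam_sub_le (hdiss : S.StrictDissipativity lam αℓ) {P : ℕ} {z : EVec n}
    {v : ℕ → EVec m} (hv : v ∈ S.admissible P z) :
    lam (S.traj z v P) - lam z ≤ S.J P z v - P * S.ell (S.zs, S.vs) := by
  have h1 := sum_le_of_dissipativity hdiss hv
  have h2 : 0 ≤ ∑ t ∈ Finset.range P, (αℓ (S.ssDist (S.traj z v t) (v t)) : ℝ) :=
    Finset.sum_nonneg fun _ _ => NNReal.coe_nonneg _
  linarith

/-- Local controllability makes the storage function continuous at the steady state. -/
theorem lam_continuousAt (hcost : S.StageCost) (hross : S.ROSS)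
    (hdiss : S.StrictDissipativity lam αℓ) (hctrl : S.LocallyControllable) {ε : ℝ}
    (hε : 0 < ε) : ∃ r : ℝ, 0 < r ∧ ∀ z, ‖z - S.zs‖ ≤ r → |lam z - lam S.zs| ≤ ε := by
  obtain ⟨-, -, K, hK, hLip⟩ := hcost
  obtain ⟨M, hM⟩ := hctrl
  obtain ⟨d, hd, hball⟩ := Metric.mem_nhds_iff.1 (mem_interior_iff_mem_nhds.1 hross.2.2)
  have hs : (S.zs, S.vs) ∈ S.tight := interior_subset hross.2.2
  -- `η < d` keeps the steering path inside `tight`, so dissipativity applies; the other bound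
  -- controls its excess cost. The factor `M + 1` covers `M = 0`.
  obtain ⟨η, hη, hηd, hηε⟩ : ∃ η : ℝ, 0 < η ∧ η < d ∧ M * (K * η) ≤ ε := by
    refine ⟨min (d / 2) (ε / ((M + 1) * K)), by positivity,
      (min_le_left _ _).trans_lt (half_lt_self hd), ?_⟩
    calc (M : ℝ) * (K * min (d / 2) (ε / ((M + 1) * K)))
        ≤ (M + 1) * (K * (ε / ((M + 1) * K))) := by
          gcongr
          · linarith
          · exact min_le_right _ _
      _ = ε := by
          have : (K : ℝ) ≠ 0 := by positivity
          field_simp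
  obtain ⟨r, hr, hctr⟩ := hM η hη
  have key : ∀ y z : EVec n, ‖y - S.zs‖ ≤ r → ‖z - S.zs‖ ≤ r → lam z - lam y ≤ ε := by
    intro y z hy hz
    obtain ⟨v, hv, hclose⟩ := hctr y z hy hz
    have hadm : v ∈ S.admissible M y := fun t ht =>
      hball (((dist_le_ssDist _ _).trans (hclose t ht)).trans_lt hηd)
    have h1 := lam_sub_le hdiss hadm
    rw [hv] at h1
    refine h1.trans (le_trans ?_ hηε)
    have h2 : S.J M y v ≤ ∑ _t ∈ Finset.range M, (S.ell (S.zs, S.vs) + K * η) := by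
      refine Finset.sum_le_sum fun t ht => ?_
      have ht := Finset.mem_range.1 ht
      have h3 := hLip.dist_le_mul _ (Or.inr (hadm t ht)) _ (Or.inr hs)
      have h4 : Dist.dist (S.traj y v t, v t) (S.zs, S.vs) ≤ η :=
        (dist_le_ssDist _ _).trans (hclose t ht)
      rw [Real.dist_eq] at h3
      have h5 := mul_le_mul_of_nonneg_left h4 K.2
      have := le_abs_self (S.ell (S.traj y v t, v t) - S.ell (S.zs, S.vs))
      change (K : ℝ) * _ ≤ K * _ at h5
      linarith
    rw [Finset.sum_const, Finset.card_range, nsmul_eq_mul, mul_add] at h2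
    linarith
  have hzs : ‖S.zs - S.zs‖ ≤ r := by simpa using hr.le
  refine ⟨r, hr, fun z hz => abs_le.2 ⟨?_, key _ _ hzs hz⟩⟩
  linarith [key _ _ hz hzs]

theorem exists_lam_majorant (hcost : S.StageCost) (hross : S.ROSS)
    (hdiss : S.StrictDissipativity lam αℓ) (hctrl : S.LocallyControllable) :
    ∃ σ : ℝ≥0 → ℝ≥0, IsClassKInf σ ∧ ∀ z, |lam z - lam S.zs| ≤ σ ‖z - S.zs‖₊ := by
  obtain ⟨C, hC⟩ := hdiss.2.1
  refine exists_isClassKInf_majorant (fun z => ‖z - S.zs‖₊) (fun z => |lam z - lam S.zs|)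
    (C + C) (fun z => (abs_sub _ _).trans (add_le_add (hC _) (hC _))) fun ε hε => ?_
  exact lam_continuousAt hcost hross hdiss hctrl hε

end Dissipativity

end TubeMPC

/-! ### Lyapunov decrease and `KL` bounds. -/

/-- A bounded sequence of distances `d` along which a function `W`, dominated by `γ ∘ d`, decreases
by at least `α ∘ d` satisfies `α ∘ d ≤ W`. -/
theorem le_of_decrease {α γ : ℝ≥0 → ℝ≥0} (hα : IsClassKInf α) (hγ : IsClassKInf γ)
    {d : ℕ → ℝ≥0} {W : ℕ → ℝ} {R : ℝ≥0} (hR : ∀ t, d t ≤ R) (hW : ∀ t, |W t| ≤ γ (d t))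
    (hdec : ∀ t, α (d t) + W (t + 1) ≤ W t) (t : ℕ) : (α (d t) : ℝ) ≤ W t := by
  have htel : ∀ T, ∑ k ∈ Finset.range T, (α (d k) : ℝ) ≤ W 0 - W T := fun T => by
    induction T with
    | zero => simp
    | succ T ih => rw [Finset.sum_range_succ]; linarith [hdec T]
  have hγR : ∀ t, |W t| ≤ γ R := fun t =>
    (hW t).trans (NNReal.coe_le_coe.2 (hγ.1.2.1.monotone (hR t)))
  have hsum : Summable fun k => (α (d k) : ℝ) :=
    summable_of_sum_range_le (c := 2 * (γ R : ℝ)) (fun _ => NNReal.coe_nonneg _) fun T => by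
      have := htel T
      have := abs_le.1 (hγR 0)
      have := abs_le.1 (hγR T)
      linarith
  have hanti : Antitone W := antitone_nat_of_succ_le fun t => by
    linarith [hdec t, (α (d t)).coe_nonneg]
  -- No sign of `W` is assumed. Summability makes `d` small at late times, where `W` is then close
  -- to zero, and monotonicity carries the lower bound back to `t`.
  have hnonneg : ∀ t, 0 ≤ W t := fun t => le_of_forall_pos_le_add fun ε hε => by
    obtain ⟨r, hr, hγr⟩ := hγ.1.exists_pos_of_le hε
    obtain ⟨η, hη, hαη⟩ := hα.exists_pos_of_lt hr
    obtain ⟨k, hkt, hk⟩ :=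
      ((eventually_ge_atTop t).and (hsum.tendsto_atTop_zero.eventually_lt_const hη)).exists
    have h1 := hγr _ (hαη _ hk).le
    have h2 := abs_le.1 (hW k)
    have h3 := hanti hkt
    linarith
  linarith [hdec t, hnonneg (t + 1)]

/-- Uniform `KL` bound from a Lyapunov-type decrease. -/
theorem exists_isClassKL_of_decrease {α γ : ℝ≥0 → ℝ≥0} (hα : IsClassKInf α)
    (hγ : IsClassKInf γ) : ∃ β : ℝ≥0 → ℝ≥0 → ℝ≥0, IsClassKL β ∧
      ∀ (d : ℕ → ℝ≥0) (W : ℕ → ℝ) (R : ℝ≥0), (∀ t, d t ≤ R) → (∀ t, |W t| ≤ γ (d t)) →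
        (∀ t, α (d t) + W (t + 1) ≤ W t) → ∀ t : ℕ, d t ≤ β (d 0) t := by
  obtain ⟨a, ha⟩ := hα.exists_orderIso
  obtain ⟨g, hg⟩ := hγ.exists_orderIso
  -- `G = α ∘ γ⁻¹ ∘ α`. For `k ≤ t`, `α (d t) ≤ W t ≤ W k ≤ γ (d k)` gives `G (d t) ≤ α (d k)`;
  -- summing over `k ≤ t` gives `(t + 1) G (d t) ≤ γ (d 0)`, which dictates `β`.
  let G : ℝ≥0 ≃o ℝ≥0 := (a.trans g.symm).trans a
  refine ⟨fun r t => G.symm (γ r / (t + 1)), ⟨fun t => ⟨?_, ?_, ?_⟩, fun r hr => ?_⟩, ?_⟩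
  · exact G.symm.continuous.comp (hγ.1.1.div_const _)
  · intro r r' hr
    have := hγ.1.2.1 hr
    refine G.symm.strictMono ?_
    gcongr
  · simp only [hγ.1.2.2, zero_div]
    exact G.symm.map_bot
  · refine (OrderIso.isClassK G.symm).isClassL_div ?_
    have := hγ.1.2.1 hr
    rwa [hγ.1.2.2] at this
  · intro d W R hR hW hdec t
    have hle := le_of_decrease hα hγ hR hW hdec
    have hanti : Antitone W := antitone_nat_of_succ_le fun t => by
      linarith [hdec t, (α (d t)).coe_nonneg]
    have hWγ : ∀ t, W t ≤ γ (d t) := fun t => (le_abs_self _).trans (hW t)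
    have hG : ∀ k ≤ t, G (d t) ≤ α (d k) := fun k hk => by
      have h1 : (α (d t) : ℝ) ≤ γ (d k) := (hle t).trans ((hanti hk).trans (hWγ k))
      rw [← ha (d k)]
      refine a.monotone ((OrderIso.symm_apply_le g).2 ?_)
      change a (d t) ≤ g (d k)
      rw [ha, hg]
      exact h1
    have htel : ∀ T, ∑ k ∈ Finset.range T, (α (d k) : ℝ) ≤ W 0 - W T := fun T => by
      induction T with
      | zero => simp
      | succ T ih => rw [Finset.sum_range_succ]; linarith [hdec T]
    have hsum : ((t + 1 : ℕ) : ℝ) * G (d t) ≤ γ (d 0) := by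
      have h1 : ∑ k ∈ Finset.range (t + 1), (G (d t) : ℝ) ≤
          ∑ k ∈ Finset.range (t + 1), (α (d k) : ℝ) := Finset.sum_le_sum fun k hk =>
        NNReal.coe_le_coe.2 (hG k (by have := Finset.mem_range.1 hk; omega))
      rw [Finset.sum_const, Finset.card_range, nsmul_eq_mul] at h1
      have h2 : 0 ≤ W (t + 1) := (NNReal.coe_nonneg _).trans (hle (t + 1))
      linarith [htel (t + 1), hWγ 0]
    rw [OrderIso.le_symm_apply, le_div_iff₀ (by positivity), mul_comm]
    rw [← NNReal.coe_le_coe]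
    push_cast at hsum ⊢
    exact hsum

/-! ### Convergence and performance of the closed loop. -/

namespace TubeMPC

variable {n m q : ℕ} {S : TubeMPC n m q}

theorem exists_convergenceBound (hmin : S.HasMinimizers) (hsets : S.ConstraintSets)
    (hrci : S.RCISet) (hcost : S.StageCost) (hterm : S.Terminal) (hross : S.ROSS)
    {lam : EVec n → ℝ} {αℓ : ℝ≥0 → ℝ≥0} (hdiss : S.StrictDissipativity lam αℓ)
    (hcldiss : S.ClosedLoopDissipativity lam αℓ) (hctrl : S.LocallyControllable)
    (hval : S.ValueContinuity) :
    ∃ β : ℝ≥0 → ℝ≥0 → ℝ≥0, IsClassKL β ∧ S.ConvergenceBound β := by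
  obtain ⟨αV, hαV, hV⟩ := hval
  obtain ⟨σ, hσ, hlam⟩ := exists_lam_majorant hcost hross hdiss hctrl
  obtain ⟨R, -, hR⟩ := exists_norm_bound_XN hmin hsets hrci
  obtain ⟨β, hβ, hbound⟩ := exists_isClassKL_of_decrease hdiss.1 (hαV.add hσ)
  refine ⟨β, hβ, fun N hN z hz => ?_⟩
  have hX := hz.mem_XN hmin hterm hN
  -- The rotated value function, normalized to vanish at `zs`.
  refine hbound _ (fun t => (S.V N (z t) - S.V N S.zs) + (lam (z t) - lam S.zs)) R
    (fun t => hR N hN _ (hX t)) (fun t => ?_) fun t => ?_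
  · push_cast
    exact (abs_add_le _ _).trans (add_le_add (hV N hN _ (hX t)) (hlam _))
  · have h1 := (closedLoop_step hmin hterm hN (hX t) (hz.2 t)).2
    have h2 := hcldiss N hN _ (hX t) _ (hz.2 t)
    have h3 := NNReal.coe_le_coe.2 (hdiss.1.1.2.1.monotone
      (nnnorm_sub_le_ssDist (S := S) (z t) (S.vOpt N (z t) 0)))
    linarith

/-! ### Optimal values at the steady state -/

theorem zs_mem_XN (hterm : S.Terminal) (N : ℕ) : S.zs ∈ S.XN N :=
  Xf_subset_XN hterm N (interior_subset hterm.2.1)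

/-- The terminal controller places `Xf` in the state projection of `tight`, so `Xf` is bounded and
hence compact. -/
theorem exists_Vf_lower_bound (hsets : S.ConstraintSets) (hrci : S.RCISet)
    (hterm : S.Terminal) : ∃ D : ℝ, ∀ z ∈ S.Xf, D ≤ S.Vf z := by
  obtain ⟨hclosed, -, hcont, κf, hκ⟩ := hterm
  obtain ⟨R, -, hR⟩ := exists_norm_bound hsets hrci
  have hcomp : IsCompact S.Xf := by
    refine (isCompact_closedBall S.zs (R : ℝ)).of_isClosed_subset hclosed fun z hz => ?_
    rw [mem_closedBall_iff_norm]
    exact NNReal.coe_le_coe.2 (hR _ _ (hκ z hz).1)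
  obtain ⟨D, hD⟩ := hcomp.bddBelow_image hcont
  exact ⟨D, fun z hz => hD ⟨z, hz, rfl⟩⟩

/-- The optimal values at the steady state, corrected by the steady-state cost, form a Cauchy
sequence. -/
theorem V_zs_le (hmin : S.HasMinimizers) (hsets : S.ConstraintSets)
    (hrci : S.RCISet) (hterm : S.Terminal)
    {lam : EVec n → ℝ} {αℓ : ℝ≥0 → ℝ≥0} (hdiss : S.StrictDissipativity lam αℓ)
    {ε : ℝ} (hε : 0 < ε) : ∃ K₀ : ℕ, 1 ≤ K₀ ∧ ∀ K, K₀ ≤ K → ∀ P : ℕ,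
      S.V K S.zs + P * S.ell (S.zs, S.vs) ≤ S.V (P + K) S.zs + ε := by
  obtain ⟨D, hD⟩ := exists_Vf_lower_bound hsets hrci hterm
  obtain ⟨C, hC⟩ := hdiss.2.1
  -- The index is shifted because minimizers are only given for horizons at least one. Appending a
  -- terminal step makes `a` decrease; dissipativity and the lower bound on `Vf` keep it bounded
  -- below.
  let a : ℕ → ℝ := fun k => S.V (k + 1) S.zs - (k + 1) * S.ell (S.zs, S.vs)
  have hanti : Antitone a := antitone_nat_of_succ_le fun k => by
    have := V_succ_le hmin hterm (by omega : 1 ≤ k + 1) (zs_mem_XN hterm (k + 1))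
    dsimp only [a]
    push_cast
    linarith
  have hbdd : BddBelow (Set.range a) := by
    refine ⟨D - 2 * C, ?_⟩
    rintro _ ⟨k, rfl⟩
    have hk : 1 ≤ k + 1 := by omega
    have hf := ((hmin _ hk).1 _ (zs_mem_XN hterm (k + 1))).1
    have h1 := lam_sub_le hdiss hf.1
    have h2 := hD _ hf.2
    have h3 := abs_le.1 (hC S.zs)
    have h4 := abs_le.1 (hC (S.traj S.zs (S.vOpt (k + 1) S.zs) (k + 1)))
    dsimp only [a]
    rw [V_eq hmin hk (zs_mem_XN hterm _), objective]
    push_cast at h1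
    linarith
  obtain ⟨k₀, hk₀⟩ :=
    ((tendsto_atTop_ciInf hanti hbdd).eventually_lt_const (lt_add_of_pos_right _ hε)).exists
  refine ⟨k₀ + 1, by omega, fun K hK P => ?_⟩
  obtain ⟨k, rfl⟩ : ∃ k, K = k + 1 := ⟨K - 1, by omega⟩
  have h1 := hanti (by omega : k₀ ≤ k)
  have h2 := ciInf_le hbdd (P + k)
  dsimp only [a] at h1 h2 hk₀
  push_cast at h2
  rw [← add_assoc]
  linarith

/-! ### Transient performance -/

/-- The horizon, the time, the closed-loop sequence and the comparison input. -/
structure Comparison (S : TubeMPC n m q) (β : ℝ≥0 → ℝ≥0 → ℝ≥0) where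
  /-- prediction horizon -/
  N : ℕ
  /-- performance horizon -/
  T : ℕ
  /-- closed-loop sequence -/
  z : ℕ → EVec n
  /-- competing input sequence -/
  v : ℕ → EVec m
  one_le : 1 ≤ N
  closedLoop : S.IsClosedLoop N z
  mem : v ∈ S.admissibleToBall (β ‖z 0 - S.zs‖₊ T) T (z 0)

/-- Two value differences, each at most `αV R`, bound the closed-loop excess over `T ℓₛ`; the
competitor can undercut `T ℓₛ` only by a storage difference of at most `2 C`. -/
theorem Jcl_sub_J_le (hmin : S.HasMinimizers) (hterm : S.Terminal)
    {lam : EVec n → ℝ} {αℓ : ℝ≥0 → ℝ≥0} (hdiss : S.StrictDissipativity lam αℓ)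
    {C : ℝ} (hC : ∀ z, |lam z| ≤ C) {αV : ℝ≥0 → ℝ≥0} (hαV : IsClassKInf αV)
    (hV : ∀ N : ℕ, 1 ≤ N → ∀ z ∈ S.XN N, |S.V N z - S.V N S.zs| ≤ αV ‖z - S.zs‖₊)
    {R : ℝ≥0} (hR : ∀ N, 1 ≤ N → ∀ z ∈ S.XN N, ‖z - S.zs‖₊ ≤ R)
    {β : ℝ≥0 → ℝ≥0 → ℝ≥0} (c : Comparison S β) :
    S.Jcl c.N c.T c.z - S.J c.T (c.z 0) c.v ≤ 2 * αV R + 2 * C := by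
  have hX := c.closedLoop.mem_XN hmin hterm c.one_le
  have h1 := c.closedLoop.Jcl_le hmin hterm c.one_le c.T
  have hb : ∀ t, |S.V c.N (c.z t) - S.V c.N S.zs| ≤ αV R := fun t =>
    (hV _ c.one_le _ (hX t)).trans
      (NNReal.coe_le_coe.2 (hαV.1.2.1.monotone (hR _ c.one_le _ (hX t))))
  have h2 := abs_le.1 (hb 0)
  have h3 := abs_le.1 (hb c.T)
  have h4 := lam_sub_le hdiss c.mem.1
  have h5 := abs_le.1 (hC (c.z 0))
  have h6 := abs_le.1 (hC (S.traj (c.z 0) c.v c.T))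
  linarith

/-- A trajectory of bounded cost is close to the steady state at some early time. -/
theorem exists_close_time {lam : EVec n → ℝ} {αℓ : ℝ≥0 → ℝ≥0}
    (hdiss : S.StrictDissipativity lam αℓ) {C : ℝ} (hC : ∀ z, |lam z| ≤ C) {B η : ℝ}
    {K T : ℕ} (hKT : K ≤ T) (hK : B + 4 * C < K * η) {z : EVec n} {v : ℕ → EVec m}
    (hv : v ∈ S.admissible T z) (hJ : S.J T z v - T * S.ell (S.zs, S.vs) ≤ B) :
    ∃ P < K, (αℓ (S.ssDist (S.traj z v P) (v P)) : ℝ) < η := by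
  by_contra! h
  obtain ⟨L, rfl⟩ := Nat.exists_eq_add_of_le hKT
  -- Each of the two pieces, before and after time `K`, costs at most `2 C` in storage, whence the
  -- `4 C`.
  have h1 := sum_le_of_dissipativity hdiss (admissible_mono hKT hv)
  have h2 := lam_sub_le hdiss (admissible_shift hv)
  have h3 : ∑ _t ∈ Finset.range K, η ≤
      ∑ t ∈ Finset.range K, (αℓ (S.ssDist (S.traj z v t) (v t)) : ℝ) :=
    Finset.sum_le_sum fun t ht => h t (Finset.mem_range.1 ht)
  rw [Finset.sum_const, Finset.card_range, nsmul_eq_mul] at h3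
  rw [J_add] at hJ
  push_cast at hJ
  have h4 := abs_le.1 (hC z)
  have h5 := abs_le.1 (hC (S.traj z v K))
  have h6 := abs_le.1 (hC (S.traj (S.traj z v K) (fun s => v (K + s)) L))
  linarith

/-- The performance gap vanishes as both horizons grow. -/
theorem Jcl_sub_J_small (hmin : S.HasMinimizers) (hsets : S.ConstraintSets)
    (hrci : S.RCISet) (hcost : S.StageCost) (hterm : S.Terminal) (hross : S.ROSS)
    {lam : EVec n → ℝ} {αℓ : ℝ≥0 → ℝ≥0} (hdiss : S.StrictDissipativity lam αℓ)
    (hctrl : S.LocallyControllable) (hval : S.ValueContinuity)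
    {β : ℝ≥0 → ℝ≥0 → ℝ≥0} (hβ : IsClassKL β) (hconv : S.ConvergenceBound β)
    {ε : ℝ} (hε : 0 < ε) : ∃ K₀ : ℕ, ∀ c : Comparison S β, K₀ ≤ c.N → K₀ ≤ c.T →
      S.Jcl c.N c.T c.z - S.J c.T (c.z 0) c.v ≤ ε := by
  obtain ⟨αV, hαV, hV⟩ := hval
  obtain ⟨R, hR0, hR⟩ := exists_norm_bound_XN hmin hsets hrci
  obtain ⟨C, hC⟩ := hdiss.2.1
  -- Five errors of `ε / 5`: the storage at times `P` and `T` of the competitor, the values at its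
  -- state at `P` and at `z T`, and the change of horizon at `zs`.
  obtain ⟨r₁, hr₁, hlam⟩ := lam_continuousAt hcost hross hdiss hctrl (by positivity : 0 < ε / 5)
  obtain ⟨r₂, hr₂, hαV'⟩ := hαV.1.exists_pos_of_le (by positivity : 0 < ε / 5)
  obtain ⟨r₃, hr₃, hball⟩ := Metric.mem_nhds_iff.1 (mem_interior_iff_mem_nhds.1 hterm.2.1)
  obtain ⟨r, hr, hrr₁, hrr₂, hrr₃⟩ : ∃ r : ℝ, 0 < r ∧ r ≤ r₁ ∧ r ≤ r₂ ∧ r ≤ r₃ :=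
    ⟨min r₁ (min r₂ r₃), by positivity, min_le_left _ _,
      (min_le_right _ _).trans (min_le_left _ _), (min_le_right _ _).trans (min_le_right _ _)⟩
  obtain ⟨η, hη, hαη⟩ := hdiss.1.exists_pos_of_lt hr
  obtain ⟨K₁, hK₁, hcauchy⟩ := V_zs_le hmin hsets hrci hterm hdiss (by positivity : 0 < ε / 5)
  obtain ⟨K₂, hK₂⟩ := exists_nat_gt ((2 * (αV R : ℝ) + 4 * C) / η)
  rw [div_lt_iff₀ hη] at hK₂
  obtain ⟨T₀, hT₀⟩ : ∃ T₀ : ℕ, ∀ T : ℕ, T₀ ≤ T → (β R T : ℝ) ≤ r := by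
    have h1 : Tendsto (fun T : ℕ => (β R T : ℝ)) atTop (𝓝 0) :=
      NNReal.tendsto_coe.2 ((hβ.2 R hR0).2.2.comp tendsto_natCast_atTop_atTop)
    exact eventually_atTop.1 (h1.eventually (ge_mem_nhds hr))
  -- Since `P < K₂`, the remaining horizon `N - P` is still at least `K₁`; `T₀` makes both endpoints
  -- at time `T` close to `zs`.
  refine ⟨K₁ + K₂ + T₀, fun c hN hT => ?_⟩
  have hX := c.closedLoop.mem_XN hmin hterm c.one_le
  have hβr : (β ‖c.z 0 - S.zs‖₊ c.T : ℝ) ≤ r :=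
    (NNReal.coe_le_coe.2 ((hβ.1 c.T).2.1.monotone (hR _ c.one_le _ (hX 0)))).trans
      (hT₀ _ (by omega))
  have hzT : ‖c.z c.T - S.zs‖ ≤ r :=
    (NNReal.coe_le_coe.2 (hconv _ c.one_le _ c.closedLoop c.T)).trans hβr
  have hφT : ‖S.traj (c.z 0) c.v c.T - S.zs‖ ≤ r := c.mem.2.trans hβr
  have h1 := c.closedLoop.Jcl_le hmin hterm c.one_le c.T
  have h2 := abs_le.1 ((hV _ c.one_le _ (hX c.T)).trans (hαV' _ (hzT.trans hrr₂)))
  rcases le_or_gt (S.J c.T (c.z 0) c.v - c.T * S.ell (S.zs, S.vs)) (2 * αV R) with hJ | hJ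
  · obtain ⟨P, hP, hPη⟩ := exists_close_time hdiss hC (by omega : K₂ ≤ c.T) hK₂ c.mem.1 hJ
    have hφP : ‖S.traj (c.z 0) c.v P - S.zs‖ < r :=
      (NNReal.coe_le_coe.2 (nnnorm_sub_le_ssDist (S := S) _ (c.v P))).trans_lt (hαη _ hPη)
    obtain ⟨K, hK⟩ := Nat.exists_eq_add_of_le (by omega : P ≤ c.N)
    obtain ⟨L, hL⟩ := Nat.exists_eq_add_of_le (by omega : P ≤ c.T)
    have hXP : S.traj (c.z 0) c.v P ∈ S.XN K :=
      Xf_subset_XN hterm K (hball (mem_ball_iff_norm.2 (hφP.trans_le hrr₃)))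
    have hK1 : 1 ≤ K := by omega
    have h3 := V_add_le hmin hterm hK1 (admissible_mono (by omega : P ≤ c.T) c.mem.1) hXP
    have h4 := abs_le.1 ((hV K hK1 _ hXP).trans (hαV' _ (hφP.le.trans hrr₂)))
    have h5 := hcauchy K (by omega) P
    have hadm := c.mem.1
    rw [hL] at hadm
    have h6 := lam_sub_le hdiss (admissible_shift hadm)
    rw [← traj_add, ← hL] at h6
    have h7 := abs_le.1 (hlam _ (hφT.trans hrr₁))
    have h8 := abs_le.1 (hlam _ (hφP.le.trans hrr₁))
    have h9 := S.J_add P L (c.z 0) c.v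
    rw [← hL] at h9
    rw [← hK] at h3 h5
    have hLT : (c.T : ℝ) = P + L := by exact_mod_cast hL
    rw [hLT] at h1
    linarith
  -- The competitor's excess already beats `V_N(z 0) - V_N(z T)`, up to `ε / 5`.
  · have h3 := abs_le.1 ((hV _ c.one_le _ (hX 0)).trans
      (NNReal.coe_le_coe.2 (hαV.1.2.1.monotone (hR _ c.one_le _ (hX 0)))))
    have h4 : (0 : ℝ) ≤ αV R := (αV R).2
    linarith

/-- Transient performance, uniformly in the horizons and the initial state. -/
theorem exists_performance_bound (hmin : S.HasMinimizers) (hsets : S.ConstraintSets)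
    (hrci : S.RCISet) (hcost : S.StageCost) (hterm : S.Terminal) (hross : S.ROSS)
    {lam : EVec n → ℝ} {αℓ : ℝ≥0 → ℝ≥0} (hdiss : S.StrictDissipativity lam αℓ)
    (hctrl : S.LocallyControllable) (hval : S.ValueContinuity)
    {β : ℝ≥0 → ℝ≥0 → ℝ≥0} (hβ : IsClassKL β) (hconv : S.ConvergenceBound β) :
    ∃ δ : ℝ≥0 → ℝ≥0, IsClassL δ ∧ ∀ c : Comparison S β,
      S.Jcl c.N c.T c.z ≤ S.J c.T (c.z 0) c.v + δ c.N + δ c.T := by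
  obtain ⟨C, hC⟩ := hdiss.2.1
  obtain ⟨R, -, hR⟩ := exists_norm_bound_XN hmin hsets hrci
  -- The size `1 / (min N T + 1)` is small exactly when both horizons are large. The majorant at
  -- this size is the bound at `N` or at `T`, hence at most their sum.
  obtain ⟨σ, hσ, hle⟩ := exists_isClassKInf_majorant
    (fun c : Comparison S β => (1 : ℝ≥0) / ((min c.N c.T : ℕ) + 1))
    (fun c => S.Jcl c.N c.T c.z - S.J c.T (c.z 0) c.v)
    (2 * hval.choose R + 2 * C)
    (fun c => Jcl_sub_J_le hmin hterm hdiss hC hval.choose_spec.1 hval.choose_spec.2 hR c)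
    fun ε hε => by
      obtain ⟨K₀, hK₀⟩ := Jcl_sub_J_small hmin hsets hrci hcost hterm hross hdiss hctrl hval
        hβ hconv hε
      refine ⟨1 / (K₀ + 1), by positivity, fun c hc => ?_⟩
      push_cast at hc
      rw [one_div_le_one_div (by positivity) (by positivity)] at hc
      have hc : K₀ ≤ min c.N c.T := by
        have : (K₀ : ℝ) ≤ (min c.N c.T : ℕ) := by push_cast; linarith
        exact_mod_cast this
      exact hK₀ c (hc.trans (min_le_left _ _)) (hc.trans (min_le_right _ _))
  refine ⟨fun t => σ (1 / (t + 1)), hσ.1.isClassL_div one_pos, fun c => ?_⟩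
  have h1 := hle c
  rcases min_choice c.N c.T with h | h <;> rw [h] at h1
  · linarith [(σ (1 / ((c.T : ℝ≥0) + 1))).coe_nonneg]
  · linarith [(σ (1 / ((c.N : ℝ≥0) + 1))).coe_nonneg]

end TubeMPC

theorem mainTheorem3 {n m q : ℕ} (S : TubeMPC n m q)
    (hmin : S.HasMinimizers)
    (hsets : S.ConstraintSets)
    (hrci : S.RCISet)
    (hcost : S.StageCost)
    (hterm : S.Terminal)
    (hross : S.ROSS)
    (lam : EVec n → ℝ) (αℓ : ℝ≥0 → ℝ≥0)
    (hdiss : S.StrictDissipativity lam αℓ)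
    (hcldiss : S.ClosedLoopDissipativity lam αℓ)
    (hreach : S.ExponentiallyReachable)
    (hctrl : S.LocallyControllable)
    (hval : S.ValueContinuity) :
    (∃ β : ℝ≥0 → ℝ≥0 → ℝ≥0, IsClassKL β ∧ S.ConvergenceBound β) ∧
    ∀ β : ℝ≥0 → ℝ≥0 → ℝ≥0, IsClassKL β → S.ConvergenceBound β →
      ∃ δ₁ δ₂ : ℝ≥0 → ℝ≥0, IsClassL δ₁ ∧ IsClassL δ₂ ∧
        ∀ N : ℕ, 1 ≤ N → ∀ T : ℕ, ∀ z : ℕ → EVec n, S.IsClosedLoop N z →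
          ((S.Jcl N T z : ℝ) : EReal) ≤
            (⨅ v ∈ S.admissibleToBall (β ‖z 0 - S.zs‖₊ T) T (z 0),
              ((S.J T (z 0) v : ℝ) : EReal)) +
            ((δ₁ N : ℝ) : EReal) + ((δ₂ T : ℝ) : EReal) := by
  refine ⟨TubeMPC.exists_convergenceBound hmin hsets hrci hcost hterm hross hdiss hcldiss hctrl
    hval, fun β hβ hconv => ?_⟩
  obtain ⟨δ, hδ, hle⟩ := TubeMPC.exists_performance_bound hmin hsets hrci hcost hterm hross
    hdiss hctrl hval hβ hconv
  refine ⟨δ, δ, hδ, hδ, fun N hN T z hz => ?_⟩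
  -- Moving the finite errors to the left leaves a lower bound for the infimum, which also covers an
  -- empty competitor set.
  rw [add_assoc, ← EReal.coe_add, ← EReal.sub_le_iff_le_add (Or.inl (EReal.coe_ne_bot _))
    (Or.inl (EReal.coe_ne_top _))]
  refine le_iInf₂ fun v hv => ?_
  rw [← EReal.coe_sub, EReal.coe_le_coe_iff]
  linarith [hle ⟨N, T, z, v, hN, hz, hv⟩]
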